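/- Let $E$ be a real Banach space with closed unit ball $B_1(0)$ and closed balls $B_r(a)$. Call a function $f$ of the *second order (at zero)* if there are constants $0<c\le C$ with $c\,t^2\le |f(t)|\le C\,t^2$ for all sufficiently small $t>0$. The modulus of convexity of $E$ is $$\delta_E(\varepsilon)=\sup\Big\{\delta\ge 0 : B_\delta\big(\tfrac{x_1+x_2}{2}\big)\subset B_1(0)\ \ \forall x_1,x_2\in B_1(0),\ \|x_1-x_2\|=\varepsilon\Big\}.$$ The modulus of nonconvexity of a closed set $A\subset E$ is $$\gamma_A(\varepsilon)=\inf\Big\{\gamma>0 : B_\gamma\big(\tfrac{x_1+x_2}{2}\big)\cap A\neq\emptyset\ \ \forall x_1,x_2\in A,\ \|x_1-x_2\|\le\varepsilon\Big\}.$$ A closed set $A$ is *weakly convex with modulus $\gamma$* on $(0,d)$ if $\gamma_A(\varepsilon)\le\gamma(\varepsilon)<\varepsilon/2$ for all $\varepsilon\in(0,d)$. The normal cone $N(A,x)$ is the set of all $p\in E^*$ for which there is a function $\alpha\ge 0$ with $\lim_{t\to+0}\alpha(t)=0$ such that $p(x-a)\ge-\alpha(\|x-a\|)\,\|x-a\|\,\|p\|$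 for all $a\in A$. **Theorem.** Let $E$ be uniformly convex with modulus of convexity $\delta_E$ of the second order, and uniformly smooth (for every $\varepsilon>0$ there is $\eta>0$ such that $\|x+y\|+\|x-y\|\le 2+\varepsilon\|y\|$ whenever $\|x\|=1$ and $\|y\|\le\eta$). Let $A\subset E$ satisfy $\operatorname{cl}\operatorname{int}A=A$, and suppose that for some $d>0$ both $A$ and $\operatorname{cl}(E\setminus A)$ are weakly convex with a modulus $\gamma$ on $(0,d)$, where $\gamma$ is of the second order. Then there is a map $p:\partial A\to E^*$, uniformly continuous with respect to the norms of $E$ and $E^*$, such that for every $x\in\partial A$ $$N(A,x)\cap\{q\in E^*:\|q\|=1\}=\{p(x)\},\qquad N(\operatorname{cl}(E\setminus A),x)\cap\{q\in E^*:\|q\|=1\}=\{-p(x)\}.$$ -/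

import Mathlib

open scoped Topology

noncomputable section

/-- Uniform smoothness of a normed space: for every `ε > 0` there is `η > 0` such that
`‖x + y‖ + ‖x - y‖ ≤ 2 + ε ‖y‖` whenever `‖x‖ = 1` and `‖y‖ ≤ η`
(equivalently, the modulus of smoothness `ρ` satisfies `ρ(τ) / τ → 0` as `τ → 0+`). -/
def IsUniformlySmooth (E : Type*) [NormedAddCommGroup E] : Prop :=
  ∀ ε : ℝ, 0 < ε → ∃ η : ℝ, 0 < η ∧
    ∀ x y : E, ‖x‖ = 1 → ‖y‖ ≤ η → ‖x + y‖ + ‖x - y‖ ≤ 2 + ε * ‖y‖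

/-- The (Polyak) modulus of convexity `δ_A(ε)` of a set `A`; only `0 ≤ ε < diam A` is relevant. -/
def convexityModulus {E : Type*} [NormedAddCommGroup E] [NormedSpace ℝ E]
    (A : Set E) (ε : ℝ) : ℝ :=
  sSup {δ : ℝ | 0 ≤ δ ∧ ∀ x₁ ∈ A, ∀ x₂ ∈ A, ‖x₁ - x₂‖ = ε →
    Metric.closedBall (midpoint ℝ x₁ x₂) δ ⊆ A}

/-- The modulus of convexity `δ_E` of a space is that of its closed unit ball. -/
def spaceConvexityModulus (E : Type*) [NormedAddCommGroup E] [NormedSpace ℝ E] (ε : ℝ) : ℝ :=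
  convexityModulus (Metric.closedBall (0 : E) 1) ε

/-- The modulus of nonconvexity `γ_A(ε)` of a set `A`; only `ε ≥ 0` is relevant. The set of
admissible `γ` is bounded below by `0`, and contains `ε / 2` when `ε > 0`. -/
def nonconvexityModulus {E : Type*} [NormedAddCommGroup E] [NormedSpace ℝ E]
    (A : Set E) (ε : ℝ) : ℝ :=
  sInf {γ : ℝ | 0 < γ ∧ ∀ x₁ ∈ A, ∀ x₂ ∈ A, ‖x₁ - x₂‖ ≤ ε →
    (Metric.closedBall (midpoint ℝ x₁ x₂) γ ∩ A).Nonempty}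

/-- `A` is weakly convex with modulus `γ` on `(0, d)`: it is closed, and its modulus of
nonconvexity is at most `γ`, where `γ(ε) < ε / 2`. -/
structure IsWeaklyConvexWith {E : Type*} [NormedAddCommGroup E] [NormedSpace ℝ E]
    (A : Set E) (γ : ℝ → ℝ) (d : ℝ) : Prop where
  isClosed : IsClosed A
  le_modulus : ∀ ε : ℝ, 0 < ε → ε < d → nonconvexityModulus A ε ≤ γ ε
  lt_half : ∀ ε : ℝ, 0 < ε → ε < d → γ ε < ε / 2

/-- A function is of the second order at zero: `f(t) ≍ t²` as `t → 0+`. -/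
def IsSecondOrderAtZero (f : ℝ → ℝ) : Prop :=
  Asymptotics.IsTheta (𝓝[>] (0 : ℝ)) f (fun t : ℝ => t ^ 2)

/-- The normal cone `N(A, x)`: all functionals `p` with
`p (x - a) ≥ -α(‖x - a‖) ‖x - a‖ ‖p‖` for all `a ∈ A`, for some function `α ≥ 0` with
`α(t) → 0` as `t → 0+`. -/
def normalCone {E : Type*} [NormedAddCommGroup E] [NormedSpace ℝ E]
    (A : Set E) (x : E) : Set (StrongDual ℝ E) :=
  {p | ∃ α : ℝ → ℝ, (∀ t, 0 ≤ α t) ∧ Filter.Tendsto α (𝓝[>] (0 : ℝ)) (𝓝 0) ∧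
    ∀ a ∈ A, -(α ‖x - a‖ * ‖x - a‖ * ‖p‖) ≤ p (x - a)}

end

/-!
Write `B = closure Aᶜ`. Then `A ∪ B = E`, and the regularity of `A` makes the situation symmetric in
`A` and `B`: the boundary of `A` is `A ∩ B`, and each of its points is a limit of points outside
`A` and of points outside `B`.

Weak convexity of second order says that the midpoint of two points of `B` at a small distance `t`
is `O(t²)`-close to `B`. Bisecting towards one endpoint `b` gives, for every `k`, a point of `B` at
distance `O(2⁻ᵏ t²)` from `b + 2⁻ᵏ (z - b)` (`HasQuadraticMidpoints.exists_dyadic`). Now take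
`a ∉ B` close to a boundary point, an almost nearest point `b ∈ B` to `a`, and a norming functional
`q` of `a - b`. No dyadic point is closer to `a` than `dist(a, B)`, and uniform smoothness allows
to linearize the norm at `a - b`, so that `q (z - b) ≤ M ‖z - b‖² + ε` for all `z ∈ B` near `b`,
with `ε` as small as desired and `M` and the neighbourhood uniform
(`exists_isQuadraticNormal_of_pos`).

If `p` is such an approximate normal to `A` and `q` one to `B`, at the same point `x`, then every
`x + w` lies in `A` or in `B`, so on a small sphere `p w` and `q w` cannot both be much larger than
`‖w‖²`. For unit functionals this forces `‖p + q‖` to be small (`norm_add_le_of_forall_le_or_le`).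
This single estimate shows that the approximate normals at a point form a Cauchy family in norm,
hence have a limit that is an exact normal (`exists_isQuadraticNormal`), that unit normals to `A`
are unique and opposite to those of `B`, and, because all constants are uniform, that they depend
uniformly continuously on the point.
-/

/-- Midpoints of pairs of points of `B` at distance `t < r` are `K t²`-close to `B`. -/
def HasQuadraticMidpoints {E : Type*} [NormedAddCommGroup E] [NormedSpace ℝ E]
    (B : Set E) (K r : ℝ) : Prop :=
  ∀ x ∈ B, ∀ y ∈ B, ‖x - y‖ < r → ∃ b ∈ B, ‖b - midpoint ℝ x y‖ ≤ K * ‖x - y‖ ^ 2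

/-- `q` is a unit functional that is normal to `B` at `x` up to a quadratic error with constant `M`
in the ball of radius `r`, and up to an additive error `ε`. For `ε = 0` this is a uniform version of
membership in the normal cone. -/
def IsQuadraticNormal {E : Type*} [NormedAddCommGroup E] [NormedSpace ℝ E]
    (B : Set E) (M r ε : ℝ) (x : E) (q : StrongDual ℝ E) : Prop :=
  ‖q‖ = 1 ∧ ∀ z ∈ B, ‖z - x‖ < r → q (z - x) ≤ M * ‖z - x‖ ^ 2 + ε

section

variable {E : Type*} [NormedAddCommGroup E] [NormedSpace ℝ E]

/-! ### Weak convexity and dyadic points -/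

lemma IsWeaklyConvexWith.hasQuadraticMidpoints {A : Set E} {γ : ℝ → ℝ} {d K r : ℝ}
    (hA : IsWeaklyConvexWith A γ d) (hrd : r ≤ d) (hγ : ∀ t, 0 < t → t < r → γ t ≤ K * t ^ 2) :
    HasQuadraticMidpoints A (K + 1) r := by
  intro x hx y hy hxy
  rcases (norm_nonneg (x - y)).eq_or_lt with h0 | h0
  · have : x = y := by rwa [eq_comm, norm_sub_eq_zero_iff] at h0
    subst this
    exact ⟨x, hx, by simp⟩
  set t := ‖x - y‖ with ht
  have h1 : nonconvexityModulus A t < γ t + t ^ 2 := by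
    have := hA.le_modulus t h0 (hxy.trans_le hrd)
    have : 0 < t ^ 2 := by positivity
    linarith
  unfold nonconvexityModulus at h1
  obtain ⟨g, ⟨-, hg⟩, hlt⟩ := exists_lt_of_csInf_lt (by
    refine ⟨t, h0, fun x₁ h₁ x₂ _ h₁₂ => ⟨x₁, ?_, h₁⟩⟩
    rw [Metric.mem_closedBall, dist_left_midpoint, dist_eq_norm, Real.norm_eq_abs,
      abs_of_pos (by norm_num : (0 : ℝ) < 2)]
    linarith [norm_nonneg (x₁ - x₂)]) h1
  obtain ⟨b, hb, hbA⟩ := hg x hx y hy le_rfl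
  refine ⟨b, hbA, ?_⟩
  rw [Metric.mem_closedBall, dist_eq_norm] at hb
  linarith [hγ t h0 hxy]

/-- Repeated bisection towards `b`: the errors made at the successive scales are halved at each
later step, and the new error at scale `2⁻ᵏ` is only `O(4⁻ᵏ)`, so that they sum to `O(2⁻ᵏ)`. -/
lemma HasQuadraticMidpoints.exists_dyadic {B : Set E} {K r : ℝ} (hB : HasQuadraticMidpoints B K r)
    (hK : 0 ≤ K) {b z : E} (hb : b ∈ B) (hz : z ∈ B) (hr : 2 * ‖z - b‖ < r)
    (hKt : 16 * K * ‖z - b‖ ≤ 1) (k : ℕ) :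
    ∃ c ∈ B, ‖c - (b + (1 / 2 : ℝ) ^ k • (z - b))‖ ≤ 16 * K * (1 / 2 : ℝ) ^ k * ‖z - b‖ ^ 2 := by
  set t := ‖z - b‖ with ht
  have ht0 : 0 ≤ t := norm_nonneg _
  -- The factor `1 - 2⁻ᵏ` makes the induction close.
  suffices h : ∃ c ∈ B, ‖c - (b + (1 / 2 : ℝ) ^ k • (z - b))‖ ≤
      16 * K * (1 - (1 / 2 : ℝ) ^ k) * (1 / 2 : ℝ) ^ k * t ^ 2 by
    obtain ⟨c, hc, h⟩ := h
    refine ⟨c, hc, h.trans ?_⟩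
    have h0 : 0 ≤ (1 / 2 : ℝ) ^ k := by positivity
    have h1 : 16 * K * (1 - (1 / 2 : ℝ) ^ k) ≤ 16 * K :=
      mul_le_of_le_one_right (by positivity) (by linarith)
    gcongr
  induction k with
  | zero => exact ⟨z, hz, by simp⟩
  | succ k ih =>
    obtain ⟨c, hc, h⟩ := ih
    set l := (1 / 2 : ℝ) ^ k with hl
    have hl0 : 0 ≤ l := by positivity
    have hl1 : l ≤ 1 := pow_le_one₀ (by norm_num) (by norm_num)
    have hbc : ‖b - c‖ ≤ 2 * l * t := by
      have e : b - c = -(c - (b + l • (z - b))) - l • (z - b) := by abel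
      have h1 : ‖b - c‖ ≤ 16 * K * (1 - l) * l * t ^ 2 + l * t := by
        rw [e]
        refine (norm_sub_le _ _).trans ?_
        rw [norm_neg, norm_smul, Real.norm_eq_abs, abs_of_nonneg hl0]
        gcongr
      have h2 : 16 * K * (1 - l) * l * t ^ 2 ≤ l * t := by
        have h3 : 16 * K * t * (1 - l) ≤ 1 * 1 :=
          mul_le_mul hKt (by linarith) (by linarith) zero_le_one
        have := mul_le_mul_of_nonneg_right h3 (mul_nonneg hl0 ht0)
        nlinarith
      linarith
    have hbcr : ‖b - c‖ < r := by
      refine (hbc.trans ?_).trans_lt hr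
      nlinarith
    obtain ⟨m, hm, hmc⟩ := hB b hb c hc hbcr
    refine ⟨m, hm, ?_⟩
    have e : m - (b + (1 / 2 : ℝ) ^ (k + 1) • (z - b)) =
        (m - midpoint ℝ b c) + (1 / 2 : ℝ) • (c - (b + l • (z - b))) := by
      rw [pow_succ, ← hl, midpoint_eq_smul_add]
      simp only [invOf_eq_inv]
      module
    have h4 : ‖b - c‖ ^ 2 ≤ (2 * l * t) ^ 2 := by gcongr
    rw [e]
    refine (norm_add_le _ _).trans ?_
    rw [norm_smul, Real.norm_eq_abs, abs_of_pos (by norm_num : (0 : ℝ) < 1 / 2), pow_succ, ← hl]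
    have h5 := mul_le_mul_of_nonneg_left h4 hK
    nlinarith

/-! ### Approximate normals -/

lemma IsQuadraticNormal.mono {B : Set E} {M r r' ε ε' : ℝ} {x : E} {q : StrongDual ℝ E}
    (h : IsQuadraticNormal B M r ε x q) (hr : r' ≤ r) (hε : ε ≤ ε') :
    IsQuadraticNormal B M r' ε' x q :=
  ⟨h.1, fun z hz hzx => (h.2 z hz (hzx.trans_le hr)).trans (by linarith)⟩

lemma IsQuadraticNormal.shift {B : Set E} {M r ε σ : ℝ} {b x : E} {q : StrongDual ℝ E}
    (h : IsQuadraticNormal B M r ε b q) (hM : 0 ≤ M) (hr : 0 < r) (hbx : ‖b - x‖ ≤ σ)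
    (hσ : σ ≤ r / 2) : IsQuadraticNormal B M (r / 2) (ε + (1 + 2 * M * r) * σ) x q := by
  refine ⟨h.1, fun z hz hzx => ?_⟩
  have hσ0 : 0 ≤ σ := (norm_nonneg _).trans hbx
  have h1 : ‖z - b‖ ≤ ‖z - x‖ + σ := by
    have : z - b = (z - x) - (b - x) := by abel
    rw [this]
    exact (norm_sub_le _ _).trans (by gcongr)
  have h2 := h.2 z hz (by linarith)
  have h3 : q (z - x) = q (z - b) + q (b - x) := by rw [← map_add]; congr 1; abel
  have h4 : q (b - x) ≤ σ := by
    refine (le_abs_self _).trans ((q.le_opNorm _).trans ?_)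
    rw [h.1, one_mul]
    exact hbx
  have h5 : ‖z - b‖ ^ 2 ≤ ‖z - x‖ ^ 2 + 2 * r * σ := by
    have : ‖z - b‖ ^ 2 ≤ (‖z - x‖ + σ) ^ 2 := by gcongr
    nlinarith
  have h6 := mul_le_mul_of_nonneg_left h5 hM
  nlinarith

/-- Uniform smoothness linearizes the norm at `w`: the norming functional `q` is its derivative. -/
lemma norm_sub_le_of_smooth {ε η : ℝ}
    (h : ∀ x y : E, ‖x‖ = 1 → ‖y‖ ≤ η → ‖x + y‖ + ‖x - y‖ ≤ 2 + ε * ‖y‖)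
    {w y : E} (hw : 0 < ‖w‖) {q : StrongDual ℝ E} (hq : ‖q‖ = 1) (hqw : q w = ‖w‖)
    (hy : ‖y‖ ≤ η * ‖w‖) : ‖w - y‖ ≤ ‖w‖ - q y + ε * ‖y‖ := by
  have hi : 0 < ‖w‖⁻¹ := inv_pos.2 hw
  have hn (v : E) : ‖‖w‖⁻¹ • v‖ = ‖w‖⁻¹ * ‖v‖ := by
    rw [norm_smul, Real.norm_eq_abs, abs_of_pos hi]
  have h1 := h (‖w‖⁻¹ • w) (‖w‖⁻¹ • y) (by rw [hn, inv_mul_cancel₀ hw.ne'])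
    (by rw [hn, inv_mul_le_iff₀ hw]; linarith)
  rw [← smul_add, ← smul_sub, hn, hn, hn] at h1
  have h2 := mul_le_mul_of_nonneg_left h1 hw.le
  have e1 : ‖w‖ * (‖w‖⁻¹ * ‖w + y‖ + ‖w‖⁻¹ * ‖w - y‖) = ‖w + y‖ + ‖w - y‖ := by
    field_simp
  have e2 : ‖w‖ * (2 + ε * (‖w‖⁻¹ * ‖y‖)) = 2 * ‖w‖ + ε * ‖y‖ := by
    field_simp
  rw [e1, e2] at h2
  have h3 : q (w + y) ≤ ‖w + y‖ := by
    refine (le_abs_self _).trans ((q.le_opNorm _).trans ?_)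
    rw [hq, one_mul]
  rw [map_add, hqw] at h3
  linarith

/-- At a boundary point of `B` there are approximate normals with arbitrarily small additive error:
the norming functionals of `a - b`, where `a ∉ B` is near `x` and `b ∈ B` is almost nearest
to `a`. -/
lemma exists_isQuadraticNormal_of_pos (hsm : IsUniformlySmooth E) {B : Set E} {K r : ℝ}
    (hBc : IsClosed B) (hB : HasQuadraticMidpoints B K (2 * r)) (hK : 0 ≤ K) (hr : 0 < r)
    (hr1 : r ≤ 1) (hKr : 16 * K * r ≤ 1) {x : E} (hx : x ∈ B) (hxc : x ∈ closure Bᶜ)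
    {ε : ℝ} (hε : 0 < ε) : ∃ q, IsQuadraticNormal B (16 * K) (r / 2) ε x q := by
  obtain ⟨η, hη, hsm⟩ := hsm (ε / 16) (by positivity)
  set L := 1 + 2 * (16 * K) * r with hL
  have hL0 : 0 < L := by positivity
  set σ := min (r / 2) (ε / (2 * L)) with hσ
  have hσ0 : 0 < σ := by positivity
  have hσr : σ ≤ r / 2 := min_le_left _ _
  have hσL : L * σ ≤ ε / 2 := by
    have : σ ≤ ε / (2 * L) := min_le_right _ _
    calc L * σ ≤ L * (ε / (2 * L)) := by gcongr
      _ = ε / 2 := by field_simp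
  obtain ⟨a, ha, hax⟩ := Metric.mem_closure_iff.1 hxc (σ / 4) (by positivity)
  have hne : B.Nonempty := ⟨x, hx⟩
  set s := Metric.infDist a B with hs
  have hs0 : 0 < s := (hBc.notMem_iff_infDist_pos hne).1 ha
  have hsσ : s ≤ σ / 4 := by
    have := Metric.infDist_le_dist_of_mem (x := a) hx
    rw [dist_comm] at this
    linarith
  -- `θ` is the relative excess of `‖a - b‖` over the distance from `a` to `B`.
  set θ := min 1 (min (ε / 16) (ε / 16 * η)) with hθ
  have hθ0 : 0 < θ := by positivity
  have hθ1 : θ ≤ 1 := min_le_left _ _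
  have hθε : θ ≤ ε / 16 := (min_le_right _ _).trans (min_le_left _ _)
  have hθη : θ ≤ ε / 16 * η := (min_le_right _ _).trans (min_le_right _ _)
  obtain ⟨b, hb, hab⟩ := (Metric.infDist_lt_iff (r := s + θ * s) hne).1
    (by have : 0 < θ * s := by positivity
        linarith)
  rw [dist_eq_norm] at hab
  have hsab (c : E) (hc : c ∈ B) : s ≤ ‖a - c‖ := by
    rw [← dist_eq_norm]; exact Metric.infDist_le_dist_of_mem hc
  have hD0 : 0 < ‖a - b‖ := hs0.trans_le (hsab b hb)
  obtain ⟨q, hq1, hqab⟩ := exists_dual_vector ℝ (a - b) hD0.ne'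
  simp only [RCLike.ofReal_real_eq_id, id_eq] at hqab
  have hbx : ‖b - x‖ ≤ σ := by
    have e : b - x = -(a - b) - (x - a) := by abel
    rw [e]
    refine (norm_sub_le _ _).trans ?_
    rw [norm_neg, ← dist_eq_norm x a]
    have : θ * s ≤ 1 * s := by gcongr
    linarith
  have key : IsQuadraticNormal B (16 * K) r (ε / 2) b q := by
    refine ⟨hq1, fun z hz hzb => ?_⟩
    set t := ‖z - b‖ with ht
    have ht0 : 0 ≤ t := norm_nonneg _
    have hKt : 16 * K * t ≤ 1 := le_trans (by gcongr) hKr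
    -- The estimate at the dyadic scale `k`, valid once the step is short compared to `a - b`.
    have step (k : ℕ) (hk : (1 / 2 : ℝ) ^ k * t ≤ η * ‖a - b‖) :
        (1 / 2 : ℝ) ^ k * q (z - b) ≤
          θ * s + (1 / 2 : ℝ) ^ k * (ε / 16 * t + 16 * K * t ^ 2) := by
      obtain ⟨c, hc, hcd⟩ := hB.exists_dyadic hK hb hz (by linarith) hKt k
      set l := (1 / 2 : ℝ) ^ k with hl
      have hl0 : 0 < l := by positivity
      have hln : ‖l • (z - b)‖ = l * t := by
        rw [norm_smul, Real.norm_eq_abs, abs_of_pos hl0]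
      have h1 := norm_sub_le_of_smooth hsm hD0 hq1 hqab (y := l • (z - b)) (by rwa [hln])
      rw [hln, map_smul, smul_eq_mul] at h1
      have h2 := hsab c hc
      have e : a - c = (a - b - l • (z - b)) - (c - (b + l • (z - b))) := by abel
      have h3 : ‖a - c‖ ≤ ‖a - b - l • (z - b)‖ + ‖c - (b + l • (z - b))‖ := by
        rw [e]; exact norm_sub_le _ _
      linarith
    have hex : ∃ k : ℕ, (1 / 2 : ℝ) ^ k * t ≤ η * ‖a - b‖ := by
      obtain ⟨k, hk⟩ := exists_pow_lt_of_lt_one (show 0 < η * ‖a - b‖ by positivity)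
        (show (1 / 2 : ℝ) < 1 by norm_num)
      refine ⟨k, le_trans ?_ hk.le⟩
      exact mul_le_of_le_one_right (by positivity) (by linarith)
    have hεt : ε / 16 * t ≤ ε / 16 := mul_le_of_le_one_right (by positivity) (by linarith)
    classical
    -- The largest admissible dyadic scale: the previous one being too long, dividing by it costs
    -- at most a factor of order `t / (η s)`.
    rcases hk : Nat.find hex with _ | j
    · have h1 := Nat.find_spec hex
      rw [hk] at h1
      have h2 := step 0 h1
      simp only [pow_zero, one_mul] at h2
      have h3 : θ * s ≤ ε / 16 * 1 := by gcongr; linarith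
      linarith
    · have h1 := Nat.find_spec hex
      have h2 := Nat.find_min hex (show j < Nat.find hex by omega)
      rw [hk] at h1
      have h3 := step (j + 1) h1
      rw [not_le] at h2
      rw [pow_succ] at h3
      set l := (1 / 2 : ℝ) ^ j with hl
      have hl0 : 0 < l := by positivity
      have h4 : η * s < l * t :=
        lt_of_le_of_lt (mul_le_mul_of_nonneg_left (hsab b hb) hη.le) h2
      have h5 : θ * s ≤ ε / 16 * (l * t) :=
        calc θ * s ≤ ε / 16 * η * s := by gcongr
          _ = ε / 16 * (η * s) := by ring
          _ ≤ ε / 16 * (l * t) := by gcongr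
      have h6 : l * q (z - b) ≤ l * (3 * (ε / 16 * t) + 16 * K * t ^ 2) := by linarith
      have h7 := le_of_mul_le_mul_left h6 hl0
      linarith
  exact ⟨q, (key.shift (by positivity) hr hbx hσr).mono le_rfl (by linarith)⟩

/-! ### Comparison of normals to complementary sets -/

/-- If no vector is sent to a large positive number by both of two unit functionals, then these are
almost opposite: `q` is small on the kernel of `p`, so it is almost a multiple of `p`, and this
multiple can only be close to `-p`. -/
lemma norm_add_le_of_forall_le_or_le {p q : StrongDual ℝ E} (hp : ‖p‖ = 1) (hq : ‖q‖ = 1) {κ : ℝ}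
    (hκ : 0 < κ) (hκ1 : κ ≤ 1 / 40) (h : ∀ w : E, p w ≤ κ * ‖w‖ ∨ q w ≤ κ * ‖w‖) :
    ‖p + q‖ ≤ 36 * κ := by
  obtain ⟨u, hu, hpu⟩ : ∃ u : E, ‖u‖ ≤ 1 ∧ 1 / 2 < p u := by
    obtain ⟨u, hu, hpu⟩ := p.exists_lt_apply_of_lt_opNorm (r := 1 / 2) (by rw [hp]; norm_num)
    rw [Real.norm_eq_abs] at hpu
    rcases lt_abs.1 hpu with h | h
    · exact ⟨u, hu.le, h⟩
    · exact ⟨-u, by rw [norm_neg]; exact hu.le, by rwa [map_neg]⟩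
  have hqu : q u ≤ κ := by
    rcases h u with h | h
    · have : κ * ‖u‖ ≤ κ * 1 := by gcongr
      linarith
    · have : κ * ‖u‖ ≤ κ * 1 := by gcongr
      linarith
  have hqu' : -1 ≤ q u := by
    have := q.le_opNorm u
    rw [hq, one_mul, Real.norm_eq_abs] at this
    linarith [(abs_le.1 (this.trans hu)).1]
  have hker (v : E) (hv : p v = 0) (hv1 : ‖v‖ ≤ 1) : q v ≤ 6 * κ := by
    have hn : ‖v + (4 * κ) • u‖ ≤ 1 + 4 * κ := by
      refine (norm_add_le _ _).trans ?_
      rw [norm_smul, Real.norm_eq_abs, abs_of_pos (by positivity)]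
      have : 4 * κ * ‖u‖ ≤ 4 * κ * 1 := by gcongr
      linarith
    have hn' := mul_le_mul_of_nonneg_left hn hκ.le
    have hw := h (v + (4 * κ) • u)
    simp only [map_add, map_smul, smul_eq_mul, hv, zero_add] at hw
    rcases hw with h | h
    · nlinarith
    · nlinarith
  have hker' (v : E) (hv : p v = 0) : |q v| ≤ 6 * κ * ‖v‖ := by
    rcases (norm_nonneg v).eq_or_lt with h0 | h0
    · have : v = 0 := norm_eq_zero.1 h0.symm
      simp [this]
    have hn : ‖‖v‖⁻¹ • v‖ ≤ 1 := by
      rw [norm_smul, norm_inv, norm_norm, inv_mul_cancel₀ h0.ne']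
    have h1 := hker (‖v‖⁻¹ • v) (by simp [hv]) hn
    have h2 := hker (-(‖v‖⁻¹ • v)) (by simp [hv]) (by rwa [norm_neg])
    simp only [map_neg, map_smul, smul_eq_mul] at h1 h2
    rw [inv_mul_le_iff₀ h0] at h1
    rw [← mul_neg, inv_mul_le_iff₀ h0] at h2
    rw [abs_le]
    constructor <;> linarith
  set l := q u / p u with hl
  have hpu0 : 0 < p u := by linarith
  have hlu : l * p u = q u := by rw [hl]; field_simp
  have hdiff : ‖q - l • p‖ ≤ 18 * κ := by
    refine ContinuousLinearMap.opNorm_le_bound _ (by positivity) fun w => ?_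
    have h1 := hker' (w - (p w / p u) • u) (by
      simp only [map_sub, map_smul, smul_eq_mul]; field_simp; ring)
    have e : q (w - (p w / p u) • u) = (q - l • p) w := by
      simp only [map_sub, map_smul, smul_eq_mul, sub_apply, smul_apply]
      rw [hl]; ring
    rw [e] at h1
    have hpw : |p w| ≤ ‖w‖ := by
      have := p.le_opNorm w
      rwa [hp, one_mul, Real.norm_eq_abs] at this
    have h2 : ‖w - (p w / p u) • u‖ ≤ 3 * ‖w‖ := by
      refine (norm_sub_le _ _).trans ?_
      rw [norm_smul, Real.norm_eq_abs, abs_div, abs_of_pos hpu0]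
      have h3 : |p w| / p u ≤ 2 * ‖w‖ := by
        rw [div_le_iff₀ hpu0]
        nlinarith [norm_nonneg w]
      have h4 : |p w| / p u * ‖u‖ ≤ 2 * ‖w‖ * 1 := by gcongr
      linarith
    rw [Real.norm_eq_abs]
    have := mul_le_mul_of_nonneg_left h2 (show 0 ≤ 6 * κ by positivity)
    linarith
  have hlp : ‖l • p‖ = |l| := by rw [norm_smul, hp, mul_one, Real.norm_eq_abs]
  have h1 := abs_norm_sub_norm_le q (l • p)
  rw [hq, hlp] at h1
  have h2 := abs_le.1 (h1.trans hdiff)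
  have hl2 : l ≤ 2 * κ := by
    rw [hl, div_le_iff₀ hpu0]
    nlinarith
  have hlneg : l < 0 := by
    by_contra h0
    rw [not_lt] at h0
    rw [abs_of_nonneg h0] at h2
    linarith
  rw [abs_of_neg hlneg] at h2
  have e : p + q = (q - l • p) + (1 + l) • p := by module
  rw [e]
  refine (norm_add_le _ _).trans ?_
  rw [norm_smul, hp, mul_one, Real.norm_eq_abs]
  have : |1 + l| ≤ 18 * κ := abs_le.2 ⟨by linarith, by linarith⟩
  linarith

/-- It suffices to know the normality of `p` to `A` and of `q` to `B` on a single sphere. -/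
lemma norm_add_le_of_sphere {A B : Set E} (hAB : A ∪ B = Set.univ) {p q : StrongDual ℝ E}
    (hp : ‖p‖ = 1) (hq : ‖q‖ = 1) {κ h : ℝ} (hκ : 0 < κ) (hκ1 : κ ≤ 1 / 40) (hh : 0 < h) {x : E}
    (hpA : ∀ z ∈ A, ‖z - x‖ = h → p (z - x) ≤ κ * h)
    (hqB : ∀ z ∈ B, ‖z - x‖ = h → q (z - x) ≤ κ * h) : ‖p + q‖ ≤ 36 * κ := by
  refine norm_add_le_of_forall_le_or_le hp hq hκ hκ1 fun w => ?_
  rcases (norm_nonneg w).eq_or_lt with h0 | h0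
  · have : w = 0 := norm_eq_zero.1 h0.symm
    simp [this]
  have hc : 0 < h / ‖w‖ := by positivity
  have e : x + (h / ‖w‖) • w - x = (h / ‖w‖) • w := by abel
  have hn : ‖x + (h / ‖w‖) • w - x‖ = h := by
    rw [e, norm_smul, Real.norm_eq_abs, abs_of_pos hc]
    field_simp
  have hrw : κ * h = h / ‖w‖ * (κ * ‖w‖) := by field_simp
  have hmem : x + (h / ‖w‖) • w ∈ A ∪ B := hAB ▸ Set.mem_univ _
  rcases hmem with hm | hm
  · left
    have := hpA _ hm hn
    rw [e, map_smul, smul_eq_mul, hrw] at this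
    exact le_of_mul_le_mul_left this hc
  · right
    have := hqB _ hm hn
    rw [e, map_smul, smul_eq_mul, hrw] at this
    exact le_of_mul_le_mul_left this hc

lemma exists_forall_norm_add_le {M r κ : ℝ} (hM : 0 ≤ M) (hr : 0 < r) (hκ : 0 < κ) :
    ∃ ε > 0, ∀ (A B : Set E) (x : E) (p q : StrongDual ℝ E), A ∪ B = Set.univ →
      IsQuadraticNormal A M r ε x p → IsQuadraticNormal B M r ε x q → ‖p + q‖ ≤ κ := by
  set k := min (κ / 36) (1 / 40) with hk
  have hk0 : 0 < k := by positivity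
  set h := min (r / 2) (k / (2 * (M + 1))) with hh
  have hh0 : 0 < h := by positivity
  have hhr : h < r := (min_le_left _ _).trans_lt (by linarith)
  have hMh : M * h ≤ k / 2 := by
    have : h ≤ k / (2 * (M + 1)) := min_le_right _ _
    rw [le_div_iff₀ (by positivity)] at this
    linarith
  refine ⟨k * h / 2, by positivity, fun A B x p q hAB hp hq => ?_⟩
  have aux (S : Set E) (f : StrongDual ℝ E) (hf : IsQuadraticNormal S M r (k * h / 2) x f) :
      ∀ z ∈ S, ‖z - x‖ = h → f (z - x) ≤ k * h := by
    intro z hz hzx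
    have h1 := hf.2 z hz (hzx ▸ hhr)
    rw [hzx] at h1
    have h2 := mul_le_mul_of_nonneg_right hMh hh0.le
    linarith
  have := norm_add_le_of_sphere hAB hp.1 hq.1 hk0 (min_le_right _ _) hh0 (aux A p hp) (aux B q hq)
  have h3 : k ≤ κ / 36 := min_le_left _ _
  linarith

/-! ### Exact normals -/

/-- Approximate normals to `A` at `x` are norm-Cauchy as the error tends to zero, since all of them
are almost opposite to any approximate normal to `B`. -/
lemma exists_isQuadraticNormal {A B : Set E} (hAB : A ∪ B = Set.univ) {M r : ℝ}
    (hM : 0 ≤ M) (hr : 0 < r) {x : E}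
    (hA : ∀ ε > 0, ∃ p, IsQuadraticNormal A M r ε x p)
    (hB : ∀ ε > 0, ∃ q, IsQuadraticNormal B M r ε x q) :
    ∃ p, IsQuadraticNormal A M r 0 x p := by
  have hpos (n : ℕ) : (0 : ℝ) < 1 / ((n : ℝ) + 1) := by positivity
  choose p hp using fun n : ℕ => hA _ (hpos n)
  have hc : CauchySeq p := by
    refine Metric.cauchySeq_iff'.2 fun δ hδ => ?_
    obtain ⟨ε, hε, hcmp⟩ := exists_forall_norm_add_le (E := E) hM hr (show 0 < δ / 3 by positivity)
    obtain ⟨N, hN⟩ := exists_nat_one_div_lt hε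
    obtain ⟨q, hq⟩ := hB ε hε
    have hpN (n : ℕ) (hn : N ≤ n) : ‖p n + q‖ ≤ δ / 3 :=
      hcmp A B x (p n) q hAB
        ((hp n).mono le_rfl ((one_div_le_one_div_of_le (by positivity) (by gcongr)).trans hN.le)) hq
    refine ⟨N, fun n hn => ?_⟩
    have e : p n - p N = (p n + q) - (p N + q) := by abel
    rw [dist_eq_norm, e]
    refine (norm_sub_le _ _).trans_lt ?_
    linarith [hpN n hn, hpN N le_rfl]
  obtain ⟨P, hP⟩ := cauchySeq_tendsto_of_complete hc
  refine ⟨P, ?_, fun z hz hzx => ?_⟩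
  · refine tendsto_nhds_unique hP.norm ?_
    simp only [(hp _).1]
    exact tendsto_const_nhds
  · have h1 : Filter.Tendsto (fun n => p n (z - x)) Filter.atTop (𝓝 (P (z - x))) :=
      ((ContinuousLinearMap.apply ℝ ℝ (z - x)).continuous.tendsto P).comp hP
    refine le_of_tendsto_of_tendsto' h1
      ((tendsto_one_div_add_atTop_nhds_zero_nat (𝕜 := ℝ)).const_add (M * ‖z - x‖ ^ 2))
      fun n => (hp n).2 z hz hzx

lemma IsQuadraticNormal.mem_normalCone {A : Set E} {M r : ℝ} {x : E} {p : StrongDual ℝ E}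
    (h : IsQuadraticNormal A M r 0 x p) (hM : 0 ≤ M) (hr : 0 < r) : p ∈ normalCone A x := by
  classical
  -- Beyond the radius `r` the bound holds because `p` has norm `1`.
  refine ⟨fun t => M * |t| + if t < r then 0 else 1, fun t => ?_, ?_, fun a ha => ?_⟩
  · have : (0 : ℝ) ≤ if t < r then 0 else 1 := by split_ifs <;> norm_num
    positivity
  · have h1 : Filter.Tendsto (fun t : ℝ => M * |t|) (𝓝[>] 0) (𝓝 0) := by
      have : Continuous fun t : ℝ => M * |t| := by fun_prop
      simpa using (this.tendsto 0).mono_left nhdsWithin_le_nhds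
    refine h1.congr' ?_
    filter_upwards [Ioo_mem_nhdsGT hr] with t ht
    simp [ht.2]
  · have e : p (x - a) = -p (a - x) := by rw [← map_neg, neg_sub]
    simp only [e, h.1, mul_one, norm_sub_rev x a, abs_norm]
    rw [neg_le_neg_iff]
    split_ifs with hlt
    · have := h.2 a ha hlt
      linarith
    · have h1 := (le_abs_self _).trans (p.le_opNorm (a - x))
      rw [h.1, one_mul] at h1
      have : 0 ≤ M * ‖a - x‖ * ‖a - x‖ := by positivity
      linarith

lemma eq_neg_of_mem_normalCone {A B : Set E} (hAB : A ∪ B = Set.univ) {M r : ℝ}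
    (hr : 0 < r) {x : E} {p q : StrongDual ℝ E}
    (hp : p ∈ normalCone A x) (hp1 : ‖p‖ = 1) (hq : IsQuadraticNormal B M r 0 x q) : p = -q := by
  obtain ⟨α, -, hα, hpA⟩ := hp
  refine eq_neg_of_add_eq_zero_left (norm_le_zero_iff.1 (le_of_forall_pos_le_add fun κ hκ => ?_))
  rw [zero_add]
  set k := min (κ / 36) (1 / 40) with hk
  have hk0 : 0 < k := by positivity
  have hMt : Filter.Tendsto (fun t : ℝ => M * t) (𝓝[>] 0) (𝓝 0) := by
    have : Continuous fun t : ℝ => M * t := by fun_prop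
    simpa using (this.tendsto 0).mono_left nhdsWithin_le_nhds
  obtain ⟨h, ⟨hαh, hMh⟩, hh0, hhr⟩ := (((hα.eventually_lt_const hk0).and
    (hMt.eventually_lt_const hk0)).and (Ioo_mem_nhdsGT hr)).exists
  have := norm_add_le_of_sphere (x := x) hAB hp1 hq.1 hk0 (min_le_right _ _) hh0
    (fun z hz hzx => by
      have h1 := hpA z hz
      rw [norm_sub_rev, hzx, hp1, ← neg_sub, map_neg, neg_le_neg_iff] at h1
      have h2 := mul_le_mul_of_nonneg_right hαh.le hh0.le
      linarith)
    (fun z hz hzx => by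
      have h1 := hq.2 z hz (hzx ▸ hhr)
      rw [hzx] at h1
      have h2 := mul_le_mul_of_nonneg_right hMh.le hh0.le
      linarith)
  have h3 : k ≤ κ / 36 := min_le_left _ _
  linarith

end

theorem theorem5p2 {E : Type*} [NormedAddCommGroup E] [NormedSpace ℝ E] [CompleteSpace E]
    [UniformConvexSpace E]
    (hδ : IsSecondOrderAtZero (spaceConvexityModulus E))
    (hsmooth : IsUniformlySmooth E)
    (A : Set E) (γ : ℝ → ℝ) (d : ℝ) (hd : 0 < d)
    (hγ : IsSecondOrderAtZero γ)
    (hA : IsWeaklyConvexWith A γ d)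
    (hAc : IsWeaklyConvexWith (closure Aᶜ) γ d)
    (hreg : closure (interior A) = A) :
    ∃ p : E → StrongDual ℝ E,
      (∀ x ∈ frontier A,
        normalCone A x ∩ Metric.sphere 0 1 = {p x} ∧
        normalCone (closure Aᶜ) x ∩ Metric.sphere 0 1 = {-p x}) ∧
      UniformContinuousOn p (frontier A) := by
  obtain ⟨C, hC0, hC⟩ := hγ.1.exists_pos
  obtain ⟨t₀, ht₀, hC⟩ := mem_nhdsGT_iff_exists_Ioo_subset.1 hC.bound
  have hKpos : 0 < C + 1 := by linarith
  set K := C + 1 with hK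
  -- The radius within which the dyadic construction works.
  set r := min 1 (min (min d t₀ / 2) (1 / (16 * K))) with hr
  have ht₀' : 0 < t₀ := ht₀
  have hr0 : 0 < r := by positivity
  have hr1 : r ≤ 1 := min_le_left _ _
  have hr2 : 2 * r ≤ min d t₀ := by
    have : r ≤ min d t₀ / 2 := (min_le_right _ _).trans (min_le_left _ _)
    linarith
  have hKr : 16 * K * r ≤ 1 := by
    have : r ≤ 1 / (16 * K) := (min_le_right _ _).trans (min_le_right _ _)
    rw [le_div_iff₀ (by positivity)] at this
    linarith
  have hγC (t : ℝ) (h0 : 0 < t) (h1 : t < 2 * r) : γ t ≤ C * t ^ 2 := by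
    have := hC ⟨h0, h1.trans_le (hr2.trans (min_le_right _ _))⟩
    simp only [Set.mem_ofPred_eq, Real.norm_eq_abs, abs_of_nonneg (sq_nonneg t)] at this
    exact (le_abs_self _).trans this
  have hmA := hA.hasQuadraticMidpoints (hr2.trans (min_le_left _ _)) hγC
  have hmB := hAc.hasQuadraticMidpoints (hr2.trans (min_le_left _ _)) hγC
  rw [← hK] at hmA hmB
  set B := closure Aᶜ with hB
  have hBc : Bᶜ = interior A := by rw [hB, closure_compl, compl_compl]
  have hAB : A ∪ B = Set.univ := by
    refine Set.eq_univ_of_forall fun z => ?_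
    by_cases hz : z ∈ A
    · exact Or.inl hz
    · exact Or.inr (subset_closure hz)
  have hBA : B ∪ A = Set.univ := by rw [Set.union_comm, hAB]
  have hfr (x : E) (hx : x ∈ frontier A) : x ∈ A ∧ x ∈ B := by
    rw [frontier_eq_closure_inter_closure, hA.isClosed.closure_eq] at hx
    exact hx
  have hM : 0 ≤ 16 * K := by positivity
  have hr' : 0 < r / 2 := by positivity
  have approxA (x : E) (hx : x ∈ frontier A) (ε : ℝ) (hε : ε > 0) :
      ∃ p, IsQuadraticNormal A (16 * K) (r / 2) ε x p :=
    exists_isQuadraticNormal_of_pos hsmooth hA.isClosed hmA hKpos.le hr0 hr1 hKr (hfr x hx).1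
      (hfr x hx).2 hε
  have approxB (x : E) (hx : x ∈ frontier A) (ε : ℝ) (hε : ε > 0) :
      ∃ p, IsQuadraticNormal B (16 * K) (r / 2) ε x p :=
    exists_isQuadraticNormal_of_pos hsmooth hAc.isClosed hmB hKpos.le hr0 hr1 hKr (hfr x hx).2
      (by rw [hBc, hreg]; exact (hfr x hx).1) hε
  have exact (x : E) : ∃ p, x ∈ frontier A → IsQuadraticNormal A (16 * K) (r / 2) 0 x p ∧
      IsQuadraticNormal B (16 * K) (r / 2) 0 x (-p) := by
    by_cases hx : x ∈ frontier A
    · obtain ⟨p, hp⟩ := exists_isQuadraticNormal hAB hM hr' (approxA x hx) (approxB x hx)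
      obtain ⟨q, hq⟩ := exists_isQuadraticNormal hBA hM hr' (approxB x hx) (approxA x hx)
      have := eq_neg_of_mem_normalCone hBA hr' (hq.mem_normalCone hM hr') hq.1 hp
      exact ⟨p, fun _ => ⟨hp, this ▸ hq⟩⟩
    · exact ⟨0, fun h => absurd h hx⟩
  choose p hp using exact
  refine ⟨p, fun x hx => ?_, ?_⟩
  · obtain ⟨hpA, hpB⟩ := hp x hx
    refine ⟨Set.Subset.antisymm (fun f hf => ?_) ?_, Set.Subset.antisymm (fun f hf => ?_) ?_⟩
    · have := eq_neg_of_mem_normalCone hAB hr' hf.1 (mem_sphere_zero_iff_norm.1 hf.2) hpB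
      rwa [neg_neg] at this
    · rintro _ rfl
      exact ⟨hpA.mem_normalCone hM hr', mem_sphere_zero_iff_norm.2 hpA.1⟩
    · exact eq_neg_of_mem_normalCone hBA hr' hf.1 (mem_sphere_zero_iff_norm.1 hf.2) hpA
    · rintro _ rfl
      exact ⟨hpB.mem_normalCone hM hr', mem_sphere_zero_iff_norm.2 hpB.1⟩
  · -- The normal `-p y` to `B` at `y` is an approximate normal at every nearby `x`, hence almost
    -- opposite to `p x`.
    refine Metric.uniformContinuousOn_iff.2 fun κ hκ => ?_
    obtain ⟨ε, hε, hcmp⟩ := exists_forall_norm_add_le (E := E) hM (half_pos hr')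
      (show 0 < κ / 2 by positivity)
    set L := 1 + 2 * (16 * K) * (r / 2) with hL
    have hL0 : 0 < L := by positivity
    refine ⟨min (r / 2 / 2) (ε / L), by positivity, fun x hx y hy hxy => ?_⟩
    have h1 : ‖y - x‖ ≤ r / 2 / 2 := by
      rw [← dist_eq_norm, dist_comm]
      exact hxy.le.trans (min_le_left _ _)
    have h2 : L * ‖y - x‖ ≤ ε := by
      have : ‖y - x‖ ≤ ε / L := by
        rw [← dist_eq_norm, dist_comm]
        exact hxy.le.trans (min_le_right _ _)
      rw [le_div_iff₀ hL0] at this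
      linarith
    have := hcmp A B x (p x) (-p y) hAB ((hp x hx).1.mono (by linarith) hε.le)
      (((hp y hy).2.shift hM hr' le_rfl h1).mono le_rfl (by rwa [zero_add]))
    rw [dist_eq_norm, sub_eq_add_neg]
    linarith
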